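/- Fix an infinite set of propositional variables (atoms) and consider formulas built from them with $\wedge,\vee,-,\top,\bot$. A sequent $\Gamma\vartriangleright\Delta$ is a pair of finite multisets of formulas. A Gentzen relation is a relation $S\vdash s$ between sets of sequents and sequents that is reflexive ($s\vdash s$), monotone ($S\vdash s$ implies $S,T\vdash s$), closed under cut (if $S\vdash t$ for all $t\in T$ and $T,U\vdash s$, then $S,U\vdash s$), and closed under substitutions ($S\vdash s$ implies $\sigma[S]\vdash\sigma(s)$). Relations are ordered by inclusion. A rule consists of a (possibly infinite) set of premise sequents and a conclusion sequent; it is valid in a Gentzen relation if its conclusion is related to its set of premises. Let $\mathcal{GB}$ be the least Gentzen relation validating all instances of the following rules ($\Longleftrightarrow$ abbreviates the rule from left to right together with its inverses, one for each of the listed sequents): - $\Gamma\vartriangleright\Delta,\varphi$ and $\Gamma\vartriangleright\Delta,\psi\ \Longleftrightarrow\ \Gamma\vartriangleright\Delta,\varphi\wedge\psi$; $\quad\varphi,\psi,\Gamma\vartriangleright\Delta\ \Longleftrightarrow\ \varphi\wedge\psi,\Gamma\vartriangleright\Delta$; - $\varphi,\Gamma\vartriangleright\Delta$ and $\psi,\Gamma\vartriangleright\Delta\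 \Longleftrightarrow\ \varphi\vee\psi,\Gamma\vartriangleright\Delta$; $\quad\Gamma\vartriangleright\Delta,\varphi,\psi\ \Longleftrightarrow\ \Gamma\vartriangleright\Delta,\varphi\vee\psi$; - $\varphi,\Gamma\vartriangleright\Delta\ \Longleftrightarrow\ \Gamma\vartriangleright\Delta,-\varphi$; $\quad\Gamma\vartriangleright\Delta,\varphi\ \Longleftrightarrow\ -\varphi,\Gamma\vartriangleright\Delta$; - the axioms $\emptyset\vartriangleright\top$ and $\bot\vartriangleright\emptyset$; from $\top,\Gamma\vartriangleright\Delta$ infer $\Gamma\vartriangleright\Delta$; from $\Gamma\vartriangleright\Delta,\bot$ infer $\Gamma\vartriangleright\Delta$; - Weakening and Contraction on both sides (but neither Identity nor Cut). A structural rule is a rule all of whose formulas are atoms. A generalized cut rule is a structural rule such that each formula occurring in it either does not occur in the conclusion (a cut formula), or occurs only on the left-hand sides or only on the right-hand sides of the sequents of the rule, premises and conclusion (a side formula). For Gentzen relations $G_1,G_2\subseteq G$, we say that $G$ enjoys $(G_1,G_2)$-interpolation if for all sequents $s,t$ with $s\vdash_G t$ there is a sequent $i$ such that $s\vdash_{G_1}i$,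 $i\vdash_{G_2}t$, and each variable occurring in $i$ occurs both in $s$ and in $t$. **Theorem.** Let $R$ be any set of generalized cut rules and let $G\mathcal{L}$ be the least Gentzen relation which extends $\mathcal{GB}$ and validates all rules in $R$. Then $G\mathcal{L}$ enjoys $(G\mathcal{L},\mathcal{GB})$-interpolation. Moreover, the same holds for arbitrary sets of premises: if $S\vdash_{G\mathcal{L}}t$ for a set $S$ of sequents and a sequent $t$, then there is a sequent $i$ such that $S\vdash_{G\mathcal{L}}i$, $i\vdash_{\mathcal{GB}}t$, and each variable occurring in $i$ occurs in some sequent of $S$ and in $t$. -/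

import Mathlib

namespace SuperBelnap

universe u

/-- Formulas over the variables `Var`, in the signature of Belnap--Dunn logic. -/
inductive Fml (Var : Type u) : Type u
  | var : Var → Fml Var
  | top : Fml Var
  | bot : Fml Var
  | neg : Fml Var → Fml Var
  | and : Fml Var → Fml Var → Fml Var
  | or : Fml Var → Fml Var → Fml Var

/-- The endomorphism of the formula algebra determined by `σ`. -/
def Fml.subst {Var : Type u} (σ : Var → Fml Var) : Fml Var → Fml Var
  | .var p => σ p
  | .top => .top
  | .bot => .bot
  | .neg φ => .neg (φ.subst σ)
  | .and φ ψ => .and (φ.subst σ) (ψ.subst σ)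
  | .or φ ψ => .or (φ.subst σ) (ψ.subst σ)

/-- The variables occurring in a formula. -/
def Fml.vars {Var : Type u} : Fml Var → Set Var
  | .var p => {p}
  | .top => ∅
  | .bot => ∅
  | .neg φ => φ.vars
  | .and φ ψ => φ.vars ∪ ψ.vars
  | .or φ ψ => φ.vars ∪ ψ.vars

/-- A sequent is a pair of finite multisets of formulas. -/
@[ext]
structure Sequent (Var : Type u) : Type u where
  lhs : Multiset (Fml Var)
  rhs : Multiset (Fml Var)

infix:45 " ⇛ " => Sequent.mk

/-- The formula `φ` is one of the formulas of the sequent `s`. -/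
def Sequent.HasFormula {Var : Type u} (s : Sequent Var) (φ : Fml Var) : Prop :=
  φ ∈ s.lhs ∨ φ ∈ s.rhs

/-- The variables occurring in a sequent. -/
def Sequent.vars {Var : Type u} (s : Sequent Var) : Set Var :=
  {p | ∃ φ, s.HasFormula φ ∧ p ∈ φ.vars}

def Sequent.subst {Var : Type u} (σ : Var → Fml Var) (s : Sequent Var) : Sequent Var :=
  s.lhs.map (Fml.subst σ) ⇛ s.rhs.map (Fml.subst σ)

/-- All formulas of the sequent are variables. -/
def Sequent.IsAtomic {Var : Type u} (s : Sequent Var) : Prop :=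
  ∀ φ, s.HasFormula φ → ∃ p, φ = Fml.var p

/-- A Gentzen relation: a relation between sets of sequents and sequents that is reflexive,
monotone, closed under cut, and closed under substitutions. -/
@[ext]
structure GentzenRelation (Var : Type u) : Type u where
  rel : Set (Sequent Var) → Sequent Var → Prop
  refl : ∀ s, rel {s} s
  mono : ∀ S T s, rel S s → rel (S ∪ T) s
  cut : ∀ S T U s, (∀ t ∈ T, rel S t) → rel (T ∪ U) s → rel (S ∪ U) s
  structural : ∀ (σ : Var → Fml Var) S s, rel S s → rel (Sequent.subst σ '' S) (s.subst σ)

instance {Var : Type u} : PartialOrder (GentzenRelation Var) where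
  le G H := ∀ S s, G.rel S s → H.rel S s
  le_refl _ _ _ h := h
  le_trans _ _ _ h k S s x := k S s (h S s x)
  le_antisymm _ _ h k := GentzenRelation.ext (funext fun S => funext fun s =>
    propext ⟨h S s, k S s⟩)

/-- A Gentzen rule: a (possibly infinite) set of premises and a conclusion. -/
structure Rule (Var : Type u) : Type u where
  premises : Set (Sequent Var)
  conclusion : Sequent Var

namespace Rule

/-- The sequents of a rule are its premises and its conclusion. -/
def sequents {Var : Type u} (r : Rule Var) : Set (Sequent Var) :=
  insert r.conclusion r.premises

/-- A structural rule contains no connective and no constant. -/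
def IsStructural {Var : Type u} (r : Rule Var) : Prop :=
  ∀ s ∈ r.sequents, s.IsAtomic

/-- The formula `φ` is one of the formulas of the rule. -/
def HasFormula {Var : Type u} (r : Rule Var) (φ : Fml Var) : Prop :=
  ∃ s ∈ r.sequents, s.HasFormula φ

/-- A cut formula of a rule occurs only in the premises. -/
def IsCutFormula {Var : Type u} (r : Rule Var) (φ : Fml Var) : Prop :=
  r.HasFormula φ ∧ ¬ r.conclusion.HasFormula φ

/-- A side formula of a rule occurs only on the left-hand sides or only on the right-hand sides
of the sequents of the rule. -/
def IsSideFormula {Var : Type u} (r : Rule Var) (φ : Fml Var) : Prop :=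
  r.HasFormula φ ∧ ((∀ s ∈ r.sequents, φ ∉ s.rhs) ∨ (∀ s ∈ r.sequents, φ ∉ s.lhs))

/-- A generalized cut rule is a structural rule each formula of which is a cut formula or a side
formula. -/
def IsGeneralizedCut {Var : Type u} (r : Rule Var) : Prop :=
  r.IsStructural ∧ ∀ φ, r.HasFormula φ → r.IsCutFormula φ ∨ r.IsSideFormula φ

end Rule

/-- The rule `r` is valid in the Gentzen relation `G`. -/
def GentzenRelation.Validates {Var : Type u} (G : GentzenRelation Var) (r : Rule Var) : Prop :=
  G.rel r.premises r.conclusion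

/-- `Derivable C S t`: there is a well-founded proof of `t` from the premises `S` all of whose
inferences are substitution instances of rules in `C`. -/
inductive Derivable {Var : Type u} (C : Set (Rule Var)) (S : Set (Sequent Var)) :
    Sequent Var → Prop
  | prem (s : Sequent Var) : s ∈ S → Derivable C S s
  | rule (r : Rule Var) (σ : Var → Fml Var) : r ∈ C →
      (∀ s ∈ r.premises, Derivable C S (s.subst σ)) → Derivable C S (r.conclusion.subst σ)

theorem Fml.subst_subst {Var : Type u} (σ τ : Var → Fml Var) (φ : Fml Var) :
    (φ.subst σ).subst τ = φ.subst (fun p => (σ p).subst τ) := by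
  induction φ <;> simp_all [Fml.subst]

theorem Sequent.subst_subst {Var : Type u} (σ τ : Var → Fml Var) (s : Sequent Var) :
    (s.subst σ).subst τ = s.subst (fun p => (σ p).subst τ) := by
  simp [Sequent.subst, Fml.subst_subst]

theorem Sequent.subst_var {Var : Type u} (s : Sequent Var) : s.subst Fml.var = s := by
  have h : ∀ φ : Fml Var, φ.subst Fml.var = φ := fun φ => by
    induction φ <;> simp_all [Fml.subst]
  simp [Sequent.subst, h]

theorem Derivable.trans {Var : Type u} {C : Set (Rule Var)} {S T : Set (Sequent Var)}
    (h : ∀ t ∈ T, Derivable C S t) {s : Sequent Var} (hs : Derivable C T s) :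
    Derivable C S s := by
  induction hs with
  | prem s hs => exact h s hs
  | rule r σ hr _ ih => exact .rule r σ hr ih

theorem Derivable.structural {Var : Type u} {C : Set (Rule Var)} {S : Set (Sequent Var)}
    (τ : Var → Fml Var) {s : Sequent Var} (hs : Derivable C S s) :
    Derivable C (Sequent.subst τ '' S) (s.subst τ) := by
  induction hs with
  | prem s hs => exact .prem _ ⟨s, hs, rfl⟩
  | rule r σ hr _ ih =>
    rw [Sequent.subst_subst]
    exact .rule r _ hr fun s hs => by
      rw [← Sequent.subst_subst]
      exact ih s hs

/-- The Gentzen relation axiomatized by a calculus, i.e. by a set of rules. -/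
def axiomatizedBy {Var : Type u} (C : Set (Rule Var)) : GentzenRelation Var where
  rel := Derivable C
  refl s := .prem s rfl
  mono _ _ _ h := h.trans fun t ht => .prem t (Or.inl ht)
  cut _ _ _ _ h k := k.trans fun t ht => ht.elim
    (fun ht => (h t ht).trans fun u hu => .prem u (Or.inl hu)) (fun ht => .prem t (Or.inr ht))
  structural σ _ _ h := h.structural σ

/-- `axiomatizedBy C` is the least Gentzen relation which validates all of the rules of `C`. -/
theorem axiomatizedBy_isLeast {Var : Type u} (C : Set (Rule Var)) :
    IsLeast {G : GentzenRelation Var | ∀ r ∈ C, G.Validates r} (axiomatizedBy C) := by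
  refine ⟨fun r hr => ?_, fun G hG S s h => ?_⟩
  · have := Derivable.rule (C := C) (S := r.premises) r Fml.var hr
      fun s hs => by rw [Sequent.subst_var]; exact .prem s hs
    rw [Sequent.subst_var] at this
    exact this
  · induction h with
    | prem s hs =>
      have h := G.mono _ S s (G.refl s)
      rwa [Set.singleton_union, Set.insert_eq_of_mem hs] at h
    | rule r σ hr _ ih =>
      have h := G.structural σ _ _ (hG r hr)
      rw [← Set.union_empty (Sequent.subst σ '' r.premises)] at h
      have h' := G.cut S _ ∅ _ (by rintro _ ⟨s, hs, rfl⟩; exact ih s hs) h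
      rwa [Set.union_empty] at h'

/-- The rules of the Gentzen calculus for the Belnap--Dunn logic: the introduction and elimination
rules for the connectives and constants, Weakening and Contraction. -/
inductive BRule {Var : Type u} : Rule Var → Prop
  | andRI (Γ Δ : Multiset (Fml Var)) (φ ψ : Fml Var) :
      BRule ⟨{Γ ⇛ φ ::ₘ Δ, Γ ⇛ ψ ::ₘ Δ}, Γ ⇛ φ.and ψ ::ₘ Δ⟩
  | andRE₁ (Γ Δ : Multiset (Fml Var)) (φ ψ : Fml Var) :
      BRule ⟨{Γ ⇛ φ.and ψ ::ₘ Δ}, Γ ⇛ φ ::ₘ Δ⟩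
  | andRE₂ (Γ Δ : Multiset (Fml Var)) (φ ψ : Fml Var) :
      BRule ⟨{Γ ⇛ φ.and ψ ::ₘ Δ}, Γ ⇛ ψ ::ₘ Δ⟩
  | andLI (Γ Δ : Multiset (Fml Var)) (φ ψ : Fml Var) :
      BRule ⟨{φ ::ₘ ψ ::ₘ Γ ⇛ Δ}, φ.and ψ ::ₘ Γ ⇛ Δ⟩
  | andLE (Γ Δ : Multiset (Fml Var)) (φ ψ : Fml Var) :
      BRule ⟨{φ.and ψ ::ₘ Γ ⇛ Δ}, φ ::ₘ ψ ::ₘ Γ ⇛ Δ⟩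
  | orLI (Γ Δ : Multiset (Fml Var)) (φ ψ : Fml Var) :
      BRule ⟨{φ ::ₘ Γ ⇛ Δ, ψ ::ₘ Γ ⇛ Δ}, φ.or ψ ::ₘ Γ ⇛ Δ⟩
  | orLE₁ (Γ Δ : Multiset (Fml Var)) (φ ψ : Fml Var) :
      BRule ⟨{φ.or ψ ::ₘ Γ ⇛ Δ}, φ ::ₘ Γ ⇛ Δ⟩
  | orLE₂ (Γ Δ : Multiset (Fml Var)) (φ ψ : Fml Var) :
      BRule ⟨{φ.or ψ ::ₘ Γ ⇛ Δ}, ψ ::ₘ Γ ⇛ Δ⟩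
  | orRI (Γ Δ : Multiset (Fml Var)) (φ ψ : Fml Var) :
      BRule ⟨{Γ ⇛ φ ::ₘ ψ ::ₘ Δ}, Γ ⇛ φ.or ψ ::ₘ Δ⟩
  | orRE (Γ Δ : Multiset (Fml Var)) (φ ψ : Fml Var) :
      BRule ⟨{Γ ⇛ φ.or ψ ::ₘ Δ}, Γ ⇛ φ ::ₘ ψ ::ₘ Δ⟩
  | negRI (Γ Δ : Multiset (Fml Var)) (φ : Fml Var) :
      BRule ⟨{φ ::ₘ Γ ⇛ Δ}, Γ ⇛ φ.neg ::ₘ Δ⟩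
  | negRE (Γ Δ : Multiset (Fml Var)) (φ : Fml Var) :
      BRule ⟨{Γ ⇛ φ.neg ::ₘ Δ}, φ ::ₘ Γ ⇛ Δ⟩
  | negLI (Γ Δ : Multiset (Fml Var)) (φ : Fml Var) :
      BRule ⟨{Γ ⇛ φ ::ₘ Δ}, φ.neg ::ₘ Γ ⇛ Δ⟩
  | negLE (Γ Δ : Multiset (Fml Var)) (φ : Fml Var) :
      BRule ⟨{φ.neg ::ₘ Γ ⇛ Δ}, Γ ⇛ φ ::ₘ Δ⟩
  | topR : BRule ⟨∅, 0 ⇛ {Fml.top}⟩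
  | topL (Γ Δ : Multiset (Fml Var)) : BRule ⟨{Fml.top ::ₘ Γ ⇛ Δ}, Γ ⇛ Δ⟩
  | botR (Γ Δ : Multiset (Fml Var)) : BRule ⟨{Γ ⇛ Fml.bot ::ₘ Δ}, Γ ⇛ Δ⟩
  | botL : BRule ⟨∅, {Fml.bot} ⇛ 0⟩
  | weakL (Γ Δ : Multiset (Fml Var)) (φ : Fml Var) : BRule ⟨{Γ ⇛ Δ}, φ ::ₘ Γ ⇛ Δ⟩
  | weakR (Γ Δ : Multiset (Fml Var)) (φ : Fml Var) : BRule ⟨{Γ ⇛ Δ}, Γ ⇛ φ ::ₘ Δ⟩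
  | contrL (Γ Δ : Multiset (Fml Var)) (φ : Fml Var) :
      BRule ⟨{φ ::ₘ φ ::ₘ Γ ⇛ Δ}, φ ::ₘ Γ ⇛ Δ⟩
  | contrR (Γ Δ : Multiset (Fml Var)) (φ : Fml Var) :
      BRule ⟨{Γ ⇛ φ ::ₘ φ ::ₘ Δ}, Γ ⇛ φ ::ₘ Δ⟩

/-- The Gentzen calculus for the Belnap--Dunn logic. -/
def calculusB (Var : Type u) : Set (Rule Var) := {r | BRule r}

/-- The Gentzen relation axiomatized by the Gentzen calculus for the Belnap--Dunn logic. -/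
def GB (Var : Type u) : GentzenRelation Var := axiomatizedBy (calculusB Var)

/-- `G` is the extension of `G₀` by the set of rules `R`: the least Gentzen relation which extends
`G₀` and validates every rule in `R`. -/
def GentzenRelation.IsExtensionBy {Var : Type u} (G G₀ : GentzenRelation Var)
    (R : Set (Rule Var)) : Prop :=
  IsLeast {H : GentzenRelation Var | G₀ ≤ H ∧ ∀ r ∈ R, H.Validates r} G

/-- The extension of `GB` by `R` exists and is given by proofs in the enlarged calculus. -/
theorem axiomatizedBy_isExtensionBy {Var : Type u} (R : Set (Rule Var)) :
    (axiomatizedBy (calculusB Var ∪ R)).IsExtensionBy (GB Var) R := by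
  have h := axiomatizedBy_isLeast (calculusB Var ∪ R)
  refine ⟨⟨(axiomatizedBy_isLeast _).2 fun r hr => h.1 r (Or.inl hr),
    fun r hr => h.1 r (Or.inr hr)⟩, fun H hH => h.2 fun r hr => ?_⟩
  rcases hr with hr | hr
  · exact hH.1 _ _ ((axiomatizedBy_isLeast (calculusB Var)).1 r hr)
  · exact hH.2 r hr

/-- `(G₁, G₂)`-interpolation for the Gentzen relation `G`. -/
def GentzenRelation.EnjoysInterpolation {Var : Type u} (G G₁ G₂ : GentzenRelation Var) : Prop :=
  G₁ ≤ G ∧ G₂ ≤ G ∧ ∀ s t : Sequent Var, G.rel {s} t →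
    ∃ i : Sequent Var, G₁.rel {s} i ∧ G₂.rel {i} t ∧ i.vars ⊆ s.vars ∩ t.vars

end SuperBelnap

namespace SuperBelnap

universe u

variable {Var : Type u}

/-! The interpolant is `t.trim V`, where `V` is the set of variables of the premises `S`. It entails
`t` already in `GB`: `⊥` on the right and `⊤` on the left can be deleted and the lost variable
restored by Weakening, and the invertible connective rules reach occurrences inside formulas
(`Derivable.untrim_cons`, `Derivable.of_trim`). That `S` proves it is shown by induction on proofs
(`Derivable.trim`). Premises are unchanged by trimming, and each `GB` rule commutes with it. In a
generalized cut rule (`Derivable.trim_of_isGeneralizedCut`) every formula of the conclusion keeps to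
one side, so trimming it amounts to changing the substitution. A cut formula may occur on both
sides, where it is trimmed in two different ways; untrimming in the premises makes its copies equal
again. -/

open Classical in
/-- Replace each occurrence of a variable outside `V` by a constant which is redundant there: by
`⊥` in the positive occurrences and by `⊤` in the negative ones, where the polarity of `φ` itself
is positive if `b = true` and negative if `b = false`. -/
noncomputable def Fml.trim (V : Set Var) : Bool → Fml Var → Fml Var
  | b, .var p => if p ∈ V then .var p else if b then .bot else .top
  | _, .top => .top
  | _, .bot => .bot
  | b, .neg φ => .neg (φ.trim V !b)
  | b, .and φ ψ => .and (φ.trim V b) (ψ.trim V b)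
  | b, .or φ ψ => .or (φ.trim V b) (ψ.trim V b)

/-- Formulas on the right-hand side are positive, those on the left-hand side are negative. -/
noncomputable def Sequent.trim (V : Set Var) (s : Sequent Var) : Sequent Var :=
  s.lhs.map (Fml.trim V false) ⇛ s.rhs.map (Fml.trim V true)

theorem Fml.vars_trim_subset (V : Set Var) (b : Bool) (φ : Fml Var) :
    (φ.trim V b).vars ⊆ V ∩ φ.vars := by
  induction φ generalizing b with
  | var p => by_cases hp : p ∈ V <;> cases b <;> simp [Fml.trim, Fml.vars, hp]
  | top => simp [Fml.trim, Fml.vars]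
  | bot => simp [Fml.trim, Fml.vars]
  | neg φ ih => exact ih _
  | and φ ψ ihφ ihψ | or φ ψ ihφ ihψ =>
    rintro p (hp | hp)
    · exact ⟨(ihφ b hp).1, Or.inl (ihφ b hp).2⟩
    · exact ⟨(ihψ b hp).1, Or.inr (ihψ b hp).2⟩

theorem Sequent.vars_trim_subset (V : Set Var) (s : Sequent Var) :
    (s.trim V).vars ⊆ V ∩ s.vars := by
  rintro p ⟨φ, hφ, hp⟩
  rcases hφ with hφ | hφ <;> obtain ⟨ψ, hψ, rfl⟩ := Multiset.mem_map.1 hφ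
  · have h := Fml.vars_trim_subset V _ ψ hp
    exact ⟨h.1, ψ, Or.inl hψ, h.2⟩
  · have h := Fml.vars_trim_subset V _ ψ hp
    exact ⟨h.1, ψ, Or.inr hψ, h.2⟩

theorem Fml.trim_eq_self {V : Set Var} (b : Bool) {φ : Fml Var} (h : φ.vars ⊆ V) :
    φ.trim V b = φ := by
  induction φ generalizing b with
  | var p => exact if_pos (h rfl)
  | top => rfl
  | bot => rfl
  | neg φ ih => rw [Fml.trim, ih _ h]
  | and φ ψ ihφ ihψ | or φ ψ ihφ ihψ =>
    rw [Fml.trim, ihφ b (Set.subset_union_left.trans h), ihψ b (Set.subset_union_right.trans h)]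

theorem Sequent.trim_eq_self {V : Set Var} {s : Sequent Var} (h : s.vars ⊆ V) :
    s.trim V = s := by
  have hl : s.lhs.map (Fml.trim V false) = s.lhs.map id := Multiset.map_congr rfl fun φ hφ =>
    Fml.trim_eq_self _ fun p hp => h ⟨φ, Or.inl hφ, hp⟩
  have hr : s.rhs.map (Fml.trim V true) = s.rhs.map id := Multiset.map_congr rfl fun φ hφ =>
    Fml.trim_eq_self _ fun p hp => h ⟨φ, Or.inr hφ, hp⟩
  rw [Sequent.trim, hl, hr, Multiset.map_id, Multiset.map_id]

/-! ### Trimming and untrimming within a calculus that contains the rules of `GB` -/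

section Derivable

variable {C : Set (Rule Var)} {S : Set (Sequent Var)}

theorem Derivable.of_bRule (hC : calculusB Var ⊆ C) {r : Rule Var} (hr : BRule r)
    (h : ∀ s ∈ r.premises, Derivable C S s) : Derivable C S r.conclusion := by
  have := Derivable.rule (C := C) (S := S) r Fml.var (hC hr) fun s hs => by
    rw [Sequent.subst_var]; exact h s hs
  rwa [Sequent.subst_var] at this

/-- The image of an instance of a rule of `GB` under trimming is again an instance of it. -/
theorem Derivable.trim_of_bRule (hC : calculusB Var ⊆ C) (V : Set Var) {r : Rule Var}
    (hr : BRule r) (σ : Var → Fml Var)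
    (h : ∀ s ∈ r.premises, Derivable C S ((s.subst σ).trim V)) :
    Derivable C S ((r.conclusion.subst σ).trim V) := by
  -- In the negation rules a formula changes sides, and the flipped polarity in `Fml.trim` for `neg`
  -- compensates for this.
  cases hr <;>
    simp only [Set.mem_insert_iff, Set.mem_singleton_iff, forall_eq_or_imp, forall_eq,
      Sequent.subst, Sequent.trim, Multiset.map_cons, Multiset.map_zero, Multiset.map_singleton,
      Fml.subst, Fml.trim, Bool.not_true, Bool.not_false] at h ⊢
  case andRI => exact .of_bRule hC (.andRI _ _ _ _) (by simpa using h)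
  case andRE₁ => exact .of_bRule hC (.andRE₁ _ _ _ _) (by simpa using h)
  case andRE₂ => exact .of_bRule hC (.andRE₂ _ _ _ _) (by simpa using h)
  case andLI => exact .of_bRule hC (.andLI _ _ _ _) (by simpa using h)
  case andLE => exact .of_bRule hC (.andLE _ _ _ _) (by simpa using h)
  case orLI => exact .of_bRule hC (.orLI _ _ _ _) (by simpa using h)
  case orLE₁ => exact .of_bRule hC (.orLE₁ _ _ _ _) (by simpa using h)
  case orLE₂ => exact .of_bRule hC (.orLE₂ _ _ _ _) (by simpa using h)
  case orRI => exact .of_bRule hC (.orRI _ _ _ _) (by simpa using h)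
  case orRE => exact .of_bRule hC (.orRE _ _ _ _) (by simpa using h)
  case negRI => exact .of_bRule hC (.negRI _ _ _) (by simpa using h)
  case negRE => exact .of_bRule hC (.negRE _ _ _) (by simpa using h)
  case negLI => exact .of_bRule hC (.negLI _ _ _) (by simpa using h)
  case negLE => exact .of_bRule hC (.negLE _ _ _) (by simpa using h)
  case topR => exact .of_bRule hC .topR (by simp)
  case topL => exact .of_bRule hC (.topL _ _) (by simpa using h)
  case botR => exact .of_bRule hC (.botR _ _) (by simpa using h)
  case botL => exact .of_bRule hC .botL (by simp)
  case weakL => exact .of_bRule hC (.weakL _ _ _) (by simpa using h)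
  case weakR => exact .of_bRule hC (.weakR _ _ _) (by simpa using h)
  case contrL => exact .of_bRule hC (.contrL _ _ _) (by simpa using h)
  case contrR => exact .of_bRule hC (.contrR _ _ _) (by simpa using h)

/-- Each connective is decomposed by an elimination rule, its parts are untrimmed, and an
introduction rule rebuilds it. Both sides are treated in one induction because negation exchanges
them. -/
theorem Derivable.untrim_cons (hC : calculusB Var ⊆ C) (V : Set Var) (φ : Fml Var) :
    (∀ Γ Δ, Derivable C S (φ.trim V false ::ₘ Γ ⇛ Δ) → Derivable C S (φ ::ₘ Γ ⇛ Δ)) ∧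
    (∀ Γ Δ, Derivable C S (Γ ⇛ φ.trim V true ::ₘ Δ) → Derivable C S (Γ ⇛ φ ::ₘ Δ)) := by
  have infer₁ {s t : Sequent Var} (hr : BRule ⟨{s}, t⟩) (h : Derivable C S s) :
      Derivable C S t := .of_bRule hC hr (by simpa using h)
  have infer₂ {s s' t : Sequent Var} (hr : BRule ⟨{s, s'}, t⟩) (h : Derivable C S s)
      (h' : Derivable C S s') : Derivable C S t := .of_bRule hC hr (by simpa using ⟨h, h'⟩)
  induction φ with
  | var p =>
    by_cases hp : p ∈ V
    · simp [Fml.trim, hp]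
    · simp only [Fml.trim, hp, if_false, if_true, Bool.false_eq_true]
      -- The constant is deleted first, then Weakening puts the variable in its place.
      exact ⟨fun Γ Δ h => infer₁ (.weakL _ _ _) (infer₁ (.topL _ _) h),
        fun Γ Δ h => infer₁ (.weakR _ _ _) (infer₁ (.botR _ _) h)⟩
  | top => exact ⟨fun _ _ h => h, fun _ _ h => h⟩
  | bot => exact ⟨fun _ _ h => h, fun _ _ h => h⟩
  | neg φ ih =>
    exact ⟨fun Γ Δ h => infer₁ (.negLI _ _ _) (ih.2 _ _ (infer₁ (.negLE _ _ _) h)),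
      fun Γ Δ h => infer₁ (.negRI _ _ _) (ih.1 _ _ (infer₁ (.negRE _ _ _) h))⟩
  | and φ ψ ihφ ihψ =>
    refine ⟨fun Γ Δ h => infer₁ (.andLI _ _ _ _) ?_,
      fun Γ Δ h => infer₂ (.andRI _ _ _ _) (ihφ.2 _ _ (infer₁ (.andRE₁ _ _ _ _) h))
        (ihψ.2 _ _ (infer₁ (.andRE₂ _ _ _ _) h))⟩
    have := ihφ.1 _ _ (infer₁ (.andLE _ _ _ _) h)
    rw [Multiset.cons_swap] at this ⊢
    exact ihψ.1 _ _ this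
  | or φ ψ ihφ ihψ =>
    refine ⟨fun Γ Δ h => infer₂ (.orLI _ _ _ _) (ihφ.1 _ _ (infer₁ (.orLE₁ _ _ _ _) h))
        (ihψ.1 _ _ (infer₁ (.orLE₂ _ _ _ _) h)),
      fun Γ Δ h => infer₁ (.orRI _ _ _ _) ?_⟩
    have := ihφ.2 _ _ (infer₁ (.orRE _ _ _ _) h)
    rw [Multiset.cons_swap] at this ⊢
    exact ihψ.2 _ _ this

/-- The context `Γ` accumulates the formulas already replaced. Indexing by `α` allows the
replacement to depend on the schematic formula of a rule, not only on its instance. -/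
theorem Derivable.map_lhs {α : Type*} {f g : α → Fml Var} {A : Multiset α}
    (hfg : ∀ a ∈ A, ∀ Γ Δ, Derivable C S (f a ::ₘ Γ ⇛ Δ) → Derivable C S (g a ::ₘ Γ ⇛ Δ))
    {Γ Δ : Multiset (Fml Var)} (h : Derivable C S (A.map f + Γ ⇛ Δ)) :
    Derivable C S (A.map g + Γ ⇛ Δ) := by
  induction A using Multiset.induction_on generalizing Γ with
  | empty => simpa using h
  | cons a A ih =>
    rw [Multiset.map_cons, Multiset.cons_add] at h ⊢
    have := hfg a (Multiset.mem_cons_self a A) _ _ h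
    rw [← Multiset.add_cons] at this ⊢
    exact ih (fun b hb => hfg b (Multiset.mem_cons_of_mem hb)) this

theorem Derivable.map_rhs {α : Type*} {f g : α → Fml Var} {A : Multiset α}
    (hfg : ∀ a ∈ A, ∀ Γ Δ, Derivable C S (Γ ⇛ f a ::ₘ Δ) → Derivable C S (Γ ⇛ g a ::ₘ Δ))
    {Γ Δ : Multiset (Fml Var)} (h : Derivable C S (Γ ⇛ A.map f + Δ)) :
    Derivable C S (Γ ⇛ A.map g + Δ) := by
  induction A using Multiset.induction_on generalizing Δ with
  | empty => simpa using h
  | cons a A ih =>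
    rw [Multiset.map_cons, Multiset.cons_add] at h ⊢
    have := hfg a (Multiset.mem_cons_self a A) _ _ h
    rw [← Multiset.add_cons] at this ⊢
    exact ih (fun b hb => hfg b (Multiset.mem_cons_of_mem hb)) this

theorem Derivable.map_sequent {α : Type*} {f f' g g' : α → Fml Var} {A B : Multiset α}
    (hl : ∀ a ∈ A, ∀ Γ Δ, Derivable C S (f a ::ₘ Γ ⇛ Δ) → Derivable C S (g a ::ₘ Γ ⇛ Δ))
    (hr : ∀ a ∈ B, ∀ Γ Δ, Derivable C S (Γ ⇛ f' a ::ₘ Δ) → Derivable C S (Γ ⇛ g' a ::ₘ Δ))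
    (h : Derivable C S (A.map f ⇛ B.map f')) : Derivable C S (A.map g ⇛ B.map g') := by
  have h₁ := Derivable.map_lhs (Γ := 0) hl (by rwa [add_zero])
  have h₂ := Derivable.map_rhs (Δ := 0) hr (by rwa [add_zero])
  rwa [add_zero, add_zero] at h₂

theorem Derivable.of_trim (hC : calculusB Var ⊆ C) (V : Set Var) {s : Sequent Var}
    (h : Derivable C S (s.trim V)) : Derivable C S s := by
  have := Derivable.map_sequent (g := id) (g' := id)
    (fun φ _ => (Derivable.untrim_cons hC V φ).1)
    (fun φ _ => (Derivable.untrim_cons hC V φ).2) h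
  rwa [Multiset.map_id, Multiset.map_id] at this

open Classical in
/-- The formulas of the conclusion of a generalized cut rule have a fixed polarity, so that the
substitution may be trimmed there, and the cut formulas can be restored in the premises. -/
theorem Derivable.trim_of_isGeneralizedCut (hC : calculusB Var ⊆ C) (V : Set Var) {r : Rule Var}
    (hrC : r ∈ C) (hr : r.IsGeneralizedCut) (σ : Var → Fml Var)
    (h : ∀ s ∈ r.premises, Derivable C S ((s.subst σ).trim V)) :
    Derivable C S ((r.conclusion.subst σ).trim V) := by
  have hmem : r.conclusion ∈ r.sequents := Set.mem_insert _ _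
  have hside {φ : Fml Var} (hφ : r.conclusion.HasFormula φ) :
      (∀ s ∈ r.sequents, φ ∉ s.rhs) ∨ (∀ s ∈ r.sequents, φ ∉ s.lhs) :=
    (hr.2 φ ⟨_, hmem, hφ⟩).elim (fun hc => absurd hφ hc.2) And.right
  -- Side formulas are trimmed with the polarity of their side; cut formulas keep their value under
  -- `σ`.
  let τ : Var → Fml Var := fun p =>
    if Fml.var p ∈ r.conclusion.lhs then (σ p).trim V false
    else if Fml.var p ∈ r.conclusion.rhs then (σ p).trim V true
    else σ p
  have hconcl : (r.conclusion.subst σ).trim V = r.conclusion.subst τ := by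
    simp only [Sequent.trim, Sequent.subst, Multiset.map_map]
    congr 1
    · refine Multiset.map_congr rfl fun φ hφ => ?_
      obtain ⟨p, rfl⟩ := hr.1 _ hmem φ (Or.inl hφ)
      simp [τ, Fml.subst, hφ]
    · refine Multiset.map_congr rfl fun φ hφ => ?_
      obtain ⟨p, rfl⟩ := hr.1 _ hmem φ (Or.inr hφ)
      -- A formula of the conclusion cannot occur on both of its sides, so the order of the tests in
      -- `τ` is harmless.
      have hφ' : Fml.var p ∉ r.conclusion.lhs := fun hl =>
        (hside (Or.inl hl)).elim (fun k => k _ hmem hφ) (fun k => k _ hmem hl)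
      simp [τ, Fml.subst, hφ, hφ']
  rw [hconcl]
  refine .rule r τ hrC fun s hs => ?_
  have hs' : s ∈ r.sequents := Set.mem_insert_of_mem _ hs
  have hprem := h s hs
  simp only [Sequent.trim, Sequent.subst, Multiset.map_map] at hprem
  refine Derivable.map_sequent (fun φ hφ Γ Δ hd => ?_) (fun φ hφ Γ Δ hd => ?_) hprem
  · obtain ⟨p, rfl⟩ := hr.1 s hs' φ (Or.inl hφ)
    -- If `p` is on the left of the conclusion, the premise is already trimmed as `τ` demands. It
    -- cannot be on the right, since it occurs on the left of a premise; otherwise it is a cut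
    -- formula and has to be untrimmed.
    by_cases hl : Fml.var p ∈ r.conclusion.lhs
    · simpa [τ, Fml.subst, hl] using hd
    · have hr' : Fml.var p ∉ r.conclusion.rhs := fun k =>
        (hside (Or.inr k)).elim (fun m => m _ hmem k) (fun m => m _ hs' hφ)
      simpa [τ, Fml.subst, hl, hr'] using (Derivable.untrim_cons hC V (σ p)).1 _ _ hd
  · obtain ⟨p, rfl⟩ := hr.1 s hs' φ (Or.inr hφ)
    have hl : Fml.var p ∉ r.conclusion.lhs := fun k =>
      (hside (Or.inl k)).elim (fun m => m _ hs' hφ) (fun m => m _ hmem k)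
    by_cases hr' : Fml.var p ∈ r.conclusion.rhs
    · simpa [τ, Fml.subst, hl, hr'] using hd
    · simpa [τ, Fml.subst, hl, hr'] using (Derivable.untrim_cons hC V (σ p)).2 _ _ hd

end Derivable

theorem Derivable.trim {R : Set (Rule Var)} (hR : ∀ r ∈ R, r.IsGeneralizedCut)
    {S : Set (Sequent Var)} {V : Set Var} (hV : ∀ s ∈ S, s.vars ⊆ V) {t : Sequent Var}
    (h : Derivable (calculusB Var ∪ R) S t) :
    Derivable (calculusB Var ∪ R) S (t.trim V) := by
  induction h with
  | prem s hs =>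
    rw [Sequent.trim_eq_self (hV s hs)]
    exact .prem s hs
  | rule r σ hr _ ih =>
    rcases hr with hr | hr
    · exact .trim_of_bRule Set.subset_union_left V hr σ ih
    · exact .trim_of_isGeneralizedCut Set.subset_union_left V (Or.inr hr) (hR r hr) σ ih

theorem exists_interpolant {R : Set (Rule Var)} (hR : ∀ r ∈ R, r.IsGeneralizedCut)
    {G : GentzenRelation Var} (hG : G.IsExtensionBy (GB Var) R)
    (S : Set (Sequent Var)) (t : Sequent Var) (h : G.rel S t) :
    ∃ i : Sequent Var, G.rel S i ∧ (GB Var).rel {i} t ∧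
      i.vars ⊆ (⋃ s ∈ S, s.vars) ∩ t.vars := by
  -- Least elements are unique, so `G` may be taken to be given by proofs, on which induction is
  -- possible.
  obtain rfl := hG.unique (axiomatizedBy_isExtensionBy R)
  exact ⟨t.trim (⋃ s ∈ S, s.vars),
    Derivable.trim hR (fun s hs => Set.subset_biUnion_of_mem (u := Sequent.vars) hs) h,
    Derivable.of_trim subset_rfl _ (.prem _ rfl), Sequent.vars_trim_subset _ t⟩

end SuperBelnap

theorem mainTheorem2 {Var : Type*} [Infinite Var]
    (R : Set (SuperBelnap.Rule Var)) (hR : ∀ r ∈ R, r.IsGeneralizedCut)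
    (G : SuperBelnap.GentzenRelation Var)
    (hG : G.IsExtensionBy (SuperBelnap.GB Var) R) :
    G.EnjoysInterpolation G (SuperBelnap.GB Var) ∧
      ∀ (S : Set (SuperBelnap.Sequent Var)) (t : SuperBelnap.Sequent Var), G.rel S t →
        ∃ i : SuperBelnap.Sequent Var, G.rel S i ∧ (SuperBelnap.GB Var).rel {i} t ∧
          i.vars ⊆ (⋃ s ∈ S, s.vars) ∩ t.vars := by
  refine ⟨⟨le_rfl, hG.1.1, fun s t h => ?_⟩, SuperBelnap.exists_interpolant hR hG⟩
  simpa using SuperBelnap.exists_interpolant hR hG {s} t h
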